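/- A (discrete) group is amenable if it carries a finitely additive left-invariant probability measure defined on all its subsets. The class of elementary amenable groups is the smallest isomorphism-invariant class of groups that contains all finite and all solvable groups and is closed under subgroups, quotients, extensions and direct limits. For a class $\mathcal{C}$ of groups, a group $G$ is residually $\mathcal{C}$ if for every $e\neq g\in G$ there is a surjective homomorphism $\varphi\colon G\to C$ with $C\in\mathcal{C}$ and $\varphi(g)\neq e$. The class of residually amenable groups is not closed under extensions by amenable groups: there is a group $G$ that is not residually amenable but has a residually amenable normal subgroup $N$ with $G/N$ amenable. Likewise, the class of residually elementary amenable groups is not closed under extensions by elementary amenable groups. In both cases a witness is the unrestricted wreath product $G=\mathrm{Sym}_0(\mathbb{Z})\wr\mathbb{Z}=\bigl(\prod_{\mathbb{Z}}\mathrm{Sym}_0(\mathbb{Z})\bigr)\rtimes\mathbb{Z}$, where $\mathrm{Sym}_0(\mathbb{Z})$ is the group of permutations of $\mathbb{Z}$ with finite support and $\mathbb{Z}$ acts on the product by shifting the coordinates, with $N=\prod_{\mathbb{Z}}\mathrm{Sym}_0(\mathbb{Z})$. The subgroup $N$ is residually amenable and residually elementary amenable, $G/N$ is amenable and elementary amenable,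 and $G$ is neither residually amenable nor residually elementary amenable. Moreover, $\prod_{\mathbb{Z}}\mathrm{Sym}_0(\mathbb{Z})$ contains a free subgroup of rank $2$, and the finitary alternating group $\mathrm{Sym}_0^+(\mathbb{Z})$ (the group of even permutations in $\mathrm{Sym}_0(\mathbb{Z})$) is simple. -/

import Mathlib

universe u

/-- A (discrete) group is amenable if it carries a finitely additive, left-invariant probability
measure defined on all of its subsets. -/
def AmenableGroup (G : Type u) [Group G] : Prop :=
  ∃ μ : Set G → ℝ, (∀ s, 0 ≤ μ s) ∧ μ Set.univ = 1 ∧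
    (∀ s t, Disjoint s t → μ (s ∪ t) = μ s + μ t) ∧
    ∀ (g : G) (s : Set G), μ ((fun x => g * x) '' s) = μ s

/-- A class of groups (invariant under isomorphism) that contains the finite groups and the
solvable groups and is closed under subgroups, quotients, extensions and direct limits. -/
structure ElementaryClosed (C : ∀ (G : Type u) [Group G], Prop) : Prop where
  iso : ∀ (G H : Type u) [Group G] [Group H], Nonempty (G ≃* H) → C G → C H
  finite : ∀ (G : Type u) [Group G], Finite G → C G
  solvable : ∀ (G : Type u) [Group G], Group.IsSolvable G → C G
  subgroup : ∀ (G : Type u) [Group G] (H : Subgroup G), C G → C H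
  quotient : ∀ (G : Type u) [Group G] (N : Subgroup G) [N.Normal], C G → C (G ⧸ N)
  extension : ∀ (G : Type u) [Group G] (N : Subgroup G) [N.Normal], C N → C (G ⧸ N) → C G
  directLimit : ∀ (ι : Type u) [Preorder ι] [IsDirectedOrder ι] [Nonempty ι]
    (F : ι → Type u) [∀ i, Group (F i)] (f : ∀ i j, i ≤ j → F i →* F j)
    [DirectedSystem F (f · · ·)], (∀ i, C (F i)) → C (DirectLimit F f)

/-- The elementary amenable groups: the smallest class with the closure properties
of `ElementaryClosed`. -/
def ElementaryAmenableGroup (G : Type u) [Group G] : Prop :=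
  ∀ C : (∀ (G : Type u) [Group G], Prop), ElementaryClosed C → C G

/-- `G` is residually `C`: every non-trivial element survives in a quotient of `G` lying in `C`. -/
def ResiduallyIn (C : ∀ (G : Type u) [Group G], Prop) (G : Type u) [Group G] : Prop :=
  ∀ g : G, g ≠ 1 → ∃ (Q : Type u) (_ : Group Q) (φ : G →* Q),
    C Q ∧ Function.Surjective φ ∧ φ g ≠ 1

/-- The class `A` is closed under extensions by groups in `B`: every group that has a normal
subgroup in `A` with quotient in `B` (every `A`-by-`B` group) is in `A`. -/
def ClosedUnderExtensionsBy (A B : ∀ (G : Type u) [Group G], Prop) : Prop :=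
  ∀ (G : Type u) [Group G] (N : Subgroup G) [N.Normal], A N → B (G ⧸ N) → A G

/-- `Sym₀(X)`: the group of permutations of `X` with finite support. -/
def FinitarySym (X : Type u) : Subgroup (Equiv.Perm X) where
  carrier := {σ | {x | σ x ≠ x}.Finite}
  one_mem' := by simp
  mul_mem' := by
    intro σ τ hσ hτ
    refine (Set.Finite.union hσ hτ).subset ?_
    intro x hx
    by_contra h
    simp only [Set.mem_union, Set.mem_ofPred_eq, not_or, not_not] at h
    exact hx (by rw [Equiv.Perm.mul_apply, h.2, h.1])
  inv_mem' := by
    intro σ hσ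
    refine Set.Finite.subset hσ ?_
    intro x hx h
    exact hx (Equiv.Perm.inv_eq_iff_eq.2 h.symm)

/-- `Sym₀⁺(X)`: the subgroup of even permutations in `Sym₀(X)`, generated by the
products of two transpositions. -/
def FinitaryAlt (X : Type u) [DecidableEq X] : Subgroup (FinitarySym X) :=
  Subgroup.closure {σ | ∃ τ₁ τ₂ : Equiv.Perm X,
    τ₁.IsSwap ∧ τ₂.IsSwap ∧ (σ : Equiv.Perm X) = τ₁ * τ₂}

/-- The unrestricted wreath product `Sym₀(ℤ) ≀ ℤ = Sym₀(ℤ)^ℤ ⋊ ℤ`, with `ℤ` acting on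
the sequences by shifting the coordinates. -/
abbrev SymWreath : Type := RegularWreathProduct (FinitarySym ℤ) (Multiplicative ℤ)

/-- The base `Sym₀(ℤ)^ℤ` of the wreath product, the kernel of the projection onto `ℤ`. -/
abbrev SymWreathBase : Subgroup SymWreath :=
  (RegularWreathProduct.rightHom : SymWreath →* Multiplicative ℤ).ker

/-! The obstruction is the free group of rank two, which embeds in no amenable and no elementary
amenable group. The first is the paradoxical decomposition of `FreeGroup (Fin 2)`. For the second,
having no such subgroup is shown to be an `ElementaryClosed` property; extensions are the hard case,
settled by `FreeGroup.containsFreeGroup_of_normal`.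

The base of the wreath product is residually amenable because its coordinates separate points and
`Sym₀` is locally finite. It nevertheless contains a free group: the regular action can be imitated,
one word at a time, by finitary permutations. Hence a map from the wreath product to a group without
free subgroups kills some `f ≠ 1` of the base. A commutator with an element of a coordinate `q`
where `f q ≠ 1` yields a nontrivial even permutation living in that coordinate alone, simplicity of
finite alternating groups then kills the whole `Sym₀⁺` there, and shifting kills it in every
coordinate. So no such map detects an even permutation placed in a single coordinate. -/

/-! ### Free subgroups of rank two and elementary amenable groups -/

open FreeGroup in
theorem FreeGroup.eq_one_of_forall_commute {w : FreeGroup (Fin 2)}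
    (h : ∀ u, w * u = u * w) : w = 1 := by
  by_contra hw
  have hne : w.toWord ≠ [] := fun h0 => hw (toWord_eq_nil_iff.1 h0)
  obtain ⟨l, t, hl⟩ := List.exists_cons_of_ne_nil hne
  -- If `k` cancels at neither end of `w`, then `k * w` starts with `k` and `w * k` starts with `l`.
  -- Of the two letters `(i, true)`, `(i, false)`, at most one cancels the last letter of `w`.
  have key : ∀ k : Fin 2 × Bool, k.1 ≠ l.1 → k ∉ (w.toWord.getLast?.map fun x => (x.1, !x.2)) →
      False := by
    intro k hk hlast
    have h1 : mk [k] * w ∈ startsWith k := by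
      apply startsWith_mk_mul
      intro h2
      simp only [startsWith, hl, Set.mem_ofPred_eq, List.getElem?_cons_zero, Option.some.injEq] at h2
      exact hk (by rw [h2])
    have h2 : w * mk [k] ∈ startsWith l := by
      have hr : IsReduced (w.toWord ++ [k]) := by
        unfold IsReduced
        rw [List.isChain_append]
        refine ⟨isReduced_toWord, List.isChain_singleton _, ?_⟩
        intro x hx y hy hxy
        simp only [List.head?_cons, Option.mem_def, Option.some.injEq] at hy
        subst hy
        by_contra hb
        apply hlast
        rw [Option.mem_def] at hx
        rw [hx]
        simp only [Option.map_some, Option.mem_def, Option.some.injEq]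
        ext1
        · exact hxy
        · simp only; revert hb; cases x.2 <;> cases k.2 <;> simp
      simp only [startsWith, Set.mem_ofPred_eq]
      rw [show w * mk [k] = mk (w.toWord ++ [k]) by rw [← mul_mk, mk_toWord], toWord_mk,
        hr.reduce_eq, hl]
      rfl
    rw [h] at h2
    simp only [startsWith, Set.mem_ofPred_eq] at h1 h2
    rw [h1] at h2
    exact hk (by rw [Option.some.inj h2])
  obtain ⟨i, hi⟩ : ∃ i : Fin 2, i ≠ l.1 := exists_ne _
  by_cases h1 : (i, true) ∈ (w.toWord.getLast?.map fun x => (x.1, !x.2))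
  · refine key (i, false) hi ?_
    rw [Option.mem_def] at h1 ⊢
    rw [h1]
    simp
  · exact key (i, true) hi h1

theorem FreeGroup.not_isSolvable_fin_two : ¬ Group.IsSolvable (FreeGroup (Fin 2)) := by
  intro h
  let f : FreeGroup (Fin 2) →* Equiv.Perm (Fin 5) :=
    FreeGroup.lift ![finRotate 5, Equiv.swap 0 (finRotate 5 0)]
  have hf : Function.Surjective f := by
    rw [← MonoidHom.range_eq_top, FreeGroup.range_lift_eq_closure]
    have := Equiv.Perm.closure_cycle_adjacent_swap (σ := finRotate 5)
      (isCycle_finRotate_of_le (by norm_num)) (by rw [support_finRotate_of_le (by norm_num)]) 0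
    rw [← this]
    congr 1
    simp [Set.pair_comm]
  exact Equiv.Perm.not_isSolvable_fin_5 (Group.isSolvable_of_surjective hf)

/-- `G` contains a free subgroup of rank two. -/
def ContainsFreeGroup (G : Type*) [Group G] : Prop :=
  ∃ φ : FreeGroup (Fin 2) →* G, Function.Injective φ

theorem ContainsFreeGroup.of_injective {G H : Type*} [Group G] [Group H]
    (h : ContainsFreeGroup G) {f : G →* H} (hf : Function.Injective f) : ContainsFreeGroup H := by
  obtain ⟨φ, hφ⟩ := h
  exact ⟨f.comp φ, hf.comp hφ⟩

theorem ContainsFreeGroup.not_isSolvable {G : Type*} [Group G]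
    (h : ContainsFreeGroup G) : ¬ Group.IsSolvable G := by
  obtain ⟨φ, hφ⟩ := h
  exact fun _ => FreeGroup.not_isSolvable_fin_two (Group.isSolvable_of_isSolvable_injective hφ)

theorem IsFreeGroup.containsFreeGroup_or_comm (G : Type*) [Group G] [IsFreeGroup G] :
    ContainsFreeGroup G ∨ ∀ a b : G, a * b = b * a := by
  rcases subsingleton_or_nontrivial (IsFreeGroup.Generators G) with h | h
  · right
    have hcomm : ∀ a b : FreeGroup (IsFreeGroup.Generators G), a * b = b * a := by
      have : ∀ a ∈ Subgroup.closure (Set.range (FreeGroup.of (α := IsFreeGroup.Generators G))),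
          ∀ b ∈ Subgroup.closure (Set.range (FreeGroup.of (α := IsFreeGroup.Generators G))),
          a * b = b * a := by
        intro a ha b hb
        refine Subgroup.closure_induction₂ (p := fun a b _ _ => a * b = b * a)
          ?_ ?_ ?_ ?_ ?_ ?_ ?_ ha hb
        · rintro _ _ ⟨i, rfl⟩ ⟨j, rfl⟩
          rw [Subsingleton.elim i j]
        · simp
        · simp
        · intro x y z _ _ _ h1 h2
          exact (Commute.mul_left h1 h2 : _)
        · intro x y z _ _ _ h1 h2
          exact (Commute.mul_right h1 h2 : _)
        · intro x y _ _ h1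
          exact (Commute.inv_left h1 : _)
        · intro x y _ _ h1
          exact (Commute.inv_right h1 : _)
      intro a b
      exact this a (by simp [FreeGroup.closure_range_of]) b (by simp [FreeGroup.closure_range_of])
    intro a b
    apply (IsFreeGroup.toFreeGroup G).injective
    rw [map_mul, map_mul, hcomm]
  · left
    obtain ⟨i, j, hij⟩ := h
    refine ContainsFreeGroup.of_injective (G := FreeGroup (IsFreeGroup.Generators G))
      ⟨FreeGroup.map ![i, j], ?_⟩ (f := (IsFreeGroup.toFreeGroup G).symm.toMonoidHom)
      (IsFreeGroup.toFreeGroup G).symm.injective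
    apply FreeGroup.map_injective
    intro x y
    fin_cases x <;> fin_cases y <;> simp [hij, hij.symm]

/-- A nontrivial normal subgroup of a free group of rank two contains such a free group. -/
theorem FreeGroup.containsFreeGroup_of_normal (M : Subgroup (FreeGroup (Fin 2))) [M.Normal]
    (hM : M ≠ ⊥) : ContainsFreeGroup M := by
  rcases IsFreeGroup.containsFreeGroup_or_comm M with h | hMc
  · exact h
  exfalso
  apply hM
  rw [Subgroup.eq_bot_iff_forall]
  intro w hw
  apply FreeGroup.eq_one_of_forall_commute
  intro u
  let q := QuotientGroup.mk' M
  -- `P` is abelian-by-cyclic, hence solvable; being free as well, it is abelian, and it contains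
  -- both `w` and `u`. So `w` is central in the free group.
  let P := (Subgroup.zpowers (q u)).comap q
  have hMP : M ≤ P := by
    intro x hx
    have : q x = 1 := (QuotientGroup.eq_one_iff x).2 hx
    simp [P, Subgroup.mem_comap, this, one_mem]
  have hMs : Group.IsSolvable M := Group.isSolvable_of_comm hMc
  have hPs : Group.IsSolvable P := by
    have : Group.IsSolvable (Subgroup.zpowers (q u)) :=
      Group.isSolvable_of_comm (by
        rintro ⟨_, m, rfl⟩ ⟨_, n, rfl⟩
        exact Subtype.ext (zpow_mul_comm _ m n))
    refine Group.isSolvable_of_ker_le_range (Subgroup.inclusion hMP)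
      (q.subgroupComap (Subgroup.zpowers (q u))) ?_
    intro x hx
    have h1 : q x.1 = 1 := congrArg Subtype.val hx
    exact ⟨⟨x.1, (QuotientGroup.eq_one_iff x.1).1 h1⟩, rfl⟩
  rcases IsFreeGroup.containsFreeGroup_or_comm P with h | hPc
  · exact absurd hPs h.not_isSolvable
  · exact congrArg Subtype.val (hPc ⟨w, hMP hw⟩ ⟨u, Subgroup.mem_zpowers (q u)⟩)

theorem elementaryClosed_not_containsFreeGroup :
    ElementaryClosed.{u} (fun G _ => ¬ ContainsFreeGroup G) where
  iso G H _ _ e hG hH := hG (hH.of_injective (f := e.some.symm.toMonoidHom) e.some.symm.injective)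
  finite G _ _ := by
    rintro ⟨φ, hφ⟩
    exact (Finite.of_injective φ hφ).not_infinite inferInstance
  solvable G _ hs h := h.not_isSolvable hs
  subgroup G _ H hG hH := hG (hH.of_injective H.subtype_injective)
  quotient G _ N _ hG := by
    rintro ⟨φ, hφ⟩
    apply hG
    -- Free groups are projective: a free subgroup of the quotient lifts.
    choose g hg using fun i => QuotientGroup.mk'_surjective N (φ (FreeGroup.of i))
    have : (QuotientGroup.mk' N).comp (FreeGroup.lift g) = φ := by
      ext i; simpa using hg i
    refine ⟨FreeGroup.lift g, Function.Injective.of_comp (f := QuotientGroup.mk' N) ?_⟩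
    rw [← MonoidHom.coe_comp, this]
    exact hφ
  extension G _ N _ hN hQ := by
    rintro ⟨φ, hφ⟩
    by_cases hM : N.comap φ = ⊥
    · refine hQ ⟨(QuotientGroup.mk' N).comp φ, ?_⟩
      rw [← MonoidHom.ker_eq_bot_iff, ← MonoidHom.comap_ker, QuotientGroup.ker_mk', hM]
    · refine hN ((FreeGroup.containsFreeGroup_of_normal _ hM).of_injective
        (f := φ.subgroupComap N) ?_)
      intro x y hxy
      exact Subtype.ext (hφ (congrArg Subtype.val hxy))
  directLimit ι _ _ _ F _ f _ hF := by
    rintro ⟨φ, hφ⟩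
    obtain ⟨i, x, y, hx, hy⟩ := DirectLimit.exists_eq_mk₂ f (φ (FreeGroup.of 0)) (φ (FreeGroup.of 1))
    apply hF i
    let m : F i →* DirectLimit F f :=
      { toFun := fun a => ⟦⟨i, a⟩⟧
        map_one' := (DirectLimit.one_def i).symm
        map_mul' := fun a b => (DirectLimit.mul_def i a b).symm }
    have : m.comp (FreeGroup.lift ![x, y]) = φ := by
      ext j
      fin_cases j
      · simpa [m] using hx.symm
      · simpa [m] using hy.symm
    refine ⟨FreeGroup.lift ![x, y], Function.Injective.of_comp (f := m) ?_⟩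
    rw [← MonoidHom.coe_comp, this]
    exact hφ

theorem ElementaryAmenableGroup.not_containsFreeGroup {G : Type u} [Group G]
    (h : ElementaryAmenableGroup G) : ¬ ContainsFreeGroup G :=
  h _ elementaryClosed_not_containsFreeGroup

/-! ### Amenability: Følner sets, quotients, subgroups, free groups -/

open Filter Topology in
open Classical in
theorem AmenableGroup.of_folner {G : Type u} {ι : Type*} [Group G] (l : Filter ι) [l.NeBot]
    (F : ι → Finset G) (hF : ∀ i, (F i).Nonempty)
    (hinv : ∀ g : G, Tendsto
      (fun i => (((F i).filter fun x => g * x ∉ F i).card : ℝ) / (F i).card) l (𝓝 0)) :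
    AmenableGroup G := by
  let U := Ultrafilter.of l
  have hU : (U : Filter ι) ≤ l := Ultrafilter.of_le l
  let m : Set G → ι → ℝ := fun S i => (((F i).filter (· ∈ S)).card : ℝ) / (F i).card
  have hpos : ∀ i, (0 : ℝ) < (F i).card := fun i => by exact_mod_cast (hF i).card_pos
  have hm0 : ∀ S i, 0 ≤ m S i := fun S i => by positivity
  have hm1 : ∀ S i, m S i ≤ 1 := fun S i => by
    rw [div_le_one (hpos i)]
    exact_mod_cast Finset.card_filter_le _ _
  have hlim : ∀ S, ∃ a, Tendsto (m S) U (𝓝 a) := by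
    intro S
    obtain ⟨a, -, ha⟩ := isCompact_Icc.ultrafilter_le_nhds' (U.map (m S))
      (Filter.mem_map.2 (Filter.univ_mem' fun i => ⟨hm0 S i, hm1 S i⟩))
    exact ⟨a, ha⟩
  choose μ hμ using hlim
  refine ⟨μ, fun S => ge_of_tendsto' (hμ S) (hm0 S), ?_, ?_, ?_⟩
  · refine tendsto_nhds_unique (hμ _) ?_
    have : m Set.univ = fun _ => 1 := by
      ext i
      simp [m, (hpos i).ne']
    rw [this]
    exact tendsto_const_nhds
  · intro S T hST
    refine tendsto_nhds_unique (hμ _) ?_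
    have : m (S ∪ T) = fun i => m S i + m T i := by
      ext i
      simp only [m, Set.mem_union, Finset.filter_or]
      rw [Finset.card_union_of_disjoint, Nat.cast_add, add_div]
      exact Finset.disjoint_filter.2 fun x _ h1 h2 => Set.disjoint_left.1 hST h1 h2
    rw [this]
    exact (hμ S).add (hμ T)
  -- Points `x` of `gS ∩ F` with `g⁻¹x ∈ F` inject into `S ∩ F`; the others are counted by the
  -- Følner condition for `g⁻¹`. The reverse inequality is the same one for `g⁻¹`.
  · have hle : ∀ (g : G) (S : Set G), μ ((fun x => g * x) '' S) ≤ μ S := by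
      intro g S
      have h1 := (hμ S).add ((hinv g⁻¹).mono_left hU)
      rw [add_zero] at h1
      refine le_of_tendsto_of_tendsto' (hμ _) h1 fun i => ?_
      simp only [m]
      rw [← add_div]
      refine div_le_div_of_nonneg_right ?_ (hpos i).le
      norm_cast
      rw [← Finset.card_filter_add_card_filter_not
        (s := (F i).filter (· ∈ (fun x => g * x) '' S)) (fun x => g⁻¹ * x ∈ F i)]
      refine Nat.add_le_add ?_ (Finset.card_le_card ?_)
      · refine Finset.card_le_card_of_injOn (fun x => g⁻¹ * x) ?_ (mul_right_injective _).injOn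
        intro x hx
        simp only [Finset.coe_filter, Finset.mem_filter, Set.mem_ofPred_eq] at hx ⊢
        obtain ⟨⟨-, y, hy, rfl⟩, h2⟩ := hx
        exact ⟨h2, by simpa using hy⟩
      · intro x hx
        simp only [Finset.mem_filter] at hx ⊢
        exact ⟨hx.1.1, hx.2⟩
    intro g S
    refine le_antisymm (hle g S) ?_
    have := hle g⁻¹ ((fun x => g * x) '' S)
    simp only [Set.image_image, inv_mul_cancel_left, Set.image_id'] at this
    exact this

open Classical in
theorem amenableGroup_multiplicative_int : AmenableGroup (Multiplicative ℤ) := by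
  refine AmenableGroup.of_folner Filter.atTop
    (fun n : ℕ => (Finset.Icc (0 : ℤ) n).map Multiplicative.ofAdd.toEmbedding)
    (fun n => by simp) ?_
  intro g
  refine squeeze_zero (fun n => by positivity)
    (g := fun n : ℕ => (2 * (g.toAdd.natAbs : ℝ)) * (1 / ((n : ℝ) + 1))) (fun n => ?_) ?_
  · rw [Finset.card_map, Int.card_Icc, mul_one_div]
    have h1 : (((n : ℤ) + 1 - 0).toNat : ℝ) = (n : ℝ) + 1 := by
      rw [sub_zero]; norm_cast
    rw [h1]
    refine div_le_div_of_nonneg_right ?_ (by positivity)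
    -- Only points within `|g|` of an end of the interval can be moved out of it.
    have h2 : ((Finset.Ico (0 : ℤ) g.toAdd.natAbs ∪ Finset.Ioc (n - g.toAdd.natAbs : ℤ) n).map
        Multiplicative.ofAdd.toEmbedding).card ≤ 2 * g.toAdd.natAbs := by
      have h3 := (Finset.card_map Multiplicative.ofAdd.toEmbedding).trans_le
        (Finset.card_union_le (Finset.Ico (0 : ℤ) g.toAdd.natAbs)
          (Finset.Ioc (n - g.toAdd.natAbs : ℤ) n))
      rw [Int.card_Ico, Int.card_Ioc] at h3
      omega
    refine le_trans (Nat.cast_le.2 ((Finset.card_le_card ?_).trans h2)) (by push_cast; rfl)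
    intro x hx
    simp only [Finset.mem_filter, Finset.mem_map_equiv, Finset.mem_union, Finset.mem_Icc,
      Finset.mem_Ico, Finset.mem_Ioc, Multiplicative.ofAdd_symm_eq, toAdd_mul] at hx ⊢
    omega
  · simpa using (tendsto_one_div_add_atTop_nhds_zero_nat (𝕜 := ℝ)).const_mul
      (2 * (g.toAdd.natAbs : ℝ))

open Classical in
/-- A directed union of finite subgroups is amenable. -/
theorem AmenableGroup.of_iSup_finite {G : Type u} [Group G] {ι : Type*} [Preorder ι]
    [IsDirectedOrder ι] [Nonempty ι] (H : ι → Subgroup G) (hH : Monotone H)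
    (hfin : ∀ i, Finite (H i)) (hmem : ∀ g, ∃ i, g ∈ H i) : AmenableGroup G := by
  refine AmenableGroup.of_folner (Filter.atTop : Filter ι)
    (fun i => (Set.toFinite (H i : Set G)).toFinset) (fun i => ⟨1, by simp [one_mem]⟩) ?_
  intro g
  obtain ⟨i, hi⟩ := hmem g
  refine tendsto_const_nhds.congr' ?_
  filter_upwards [Filter.eventually_ge_atTop i] with j hj
  rw [Finset.filter_false_of_mem]
  · simp
  · intro x hx
    simp only [Set.Finite.mem_toFinset, SetLike.mem_coe, not_not] at hx ⊢
    exact mul_mem (hH hj hi) hx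

theorem AmenableGroup.of_surjective {G H : Type u} [Group G] [Group H] (f : G →* H)
    (hf : Function.Surjective f) (h : AmenableGroup G) : AmenableGroup H := by
  obtain ⟨μ, h0, h1, hadd, hinv⟩ := h
  refine ⟨fun S => μ (f ⁻¹' S), fun S => h0 _, by simpa using h1, ?_, ?_⟩
  · intro S T hST
    exact hadd _ _ (hST.preimage f)
  · intro h S
    obtain ⟨g, rfl⟩ := hf h
    simp only
    rw [← hinv g (f ⁻¹' S)]
    congr 1
    ext x
    constructor
    · rintro ⟨y, hy, hxy⟩
      refine ⟨g⁻¹ * x, ?_, by simp⟩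
      simp only [Set.mem_preimage, map_mul, map_inv, ← hxy]
      simpa using hy
    · rintro ⟨y, hy, rfl⟩
      exact ⟨f y, hy, by simp⟩

theorem AmenableGroup.of_injective {G : Type*} {H : Type u} [Group G] [Group H] (f : G →* H)
    (hf : Function.Injective f) (h : AmenableGroup H) : AmenableGroup G := by
  obtain ⟨μ, h0, h1, hadd, hinv⟩ := h
  -- A transversal of the orbits of `f.range` gives an equivariant map `H → G`, along which the
  -- measure is pushed forward.
  obtain ⟨r, hr⟩ : ∃ r : H → G, ∀ g x, r (f g * x) = g * r x := by
    let s := MulAction.orbitRel f.range H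
    have key : ∀ x : H, ∃ g : G, f g * (Quotient.mk s x).out = x := by
      intro x
      obtain ⟨⟨_, g, rfl⟩, hg⟩ := (Quotient.exact (Quotient.out_eq (Quotient.mk s x)) :
        _ ∈ MulAction.orbit f.range x)
      refine ⟨g⁻¹, ?_⟩
      rw [← hg]
      simp [Subgroup.smul_def]
    choose r hr using key
    refine ⟨r, fun g x => hf ?_⟩
    have h1 : Quotient.mk s (f g * x) = Quotient.mk s x :=
      Quotient.sound ⟨⟨f g, g, rfl⟩, rfl⟩
    have h2 := hr (f g * x)
    rw [h1] at h2
    apply mul_right_cancel (b := (Quotient.mk s x).out)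
    rw [h2, map_mul, mul_assoc, hr]
  refine ⟨fun S => μ (r ⁻¹' S), fun S => h0 _, by simpa using h1, ?_, ?_⟩
  · intro S T hST
    exact hadd _ _ (hST.preimage r)
  · intro g S
    simp only
    rw [← hinv (f g) (r ⁻¹' S)]
    congr 1
    ext x
    constructor
    · rintro ⟨y, hy, hxy⟩
      refine ⟨f g⁻¹ * x, ?_, by simp⟩
      rw [Set.mem_preimage, hr, ← hxy]
      simpa using hy
    · rintro ⟨y, hy, rfl⟩
      exact ⟨r y, hy, (hr _ _).symm⟩

-- Left multiplication by a generator sends the words not starting with its inverse into those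
-- starting with it. So each generator accounts for measure at least 1, and the two contributions
-- are disjoint.
open FreeGroup in
theorem FreeGroup.not_amenableGroup_fin_two : ¬ AmenableGroup (FreeGroup (Fin 2)) := by
  rintro ⟨μ, h0, h1, hadd, hinv⟩
  have hmono : ∀ S T : Set (FreeGroup (Fin 2)), S ⊆ T → μ S ≤ μ T := by
    intro S T hST
    have := hadd S (T \ S) Set.disjoint_sdiff_right
    rw [Set.union_sdiff_cancel hST] at this
    linarith [h0 (T \ S)]
  have hpair : ∀ i : Fin 2, 1 ≤ μ (startsWith (i, true)) + μ (startsWith (i, false)) := by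
    intro i
    have hc := hadd (startsWith (i, false)) (startsWith (i, false))ᶜ disjoint_compl_right
    rw [Set.union_compl_self, h1] at hc
    have : μ (startsWith (i, false))ᶜ ≤ μ (startsWith (i, true)) := by
      rw [← hinv (mk [(i, true)])]
      apply hmono
      rintro _ ⟨g, hg, rfl⟩
      exact startsWith_mk_mul g hg
    linarith
  have hdisj : ∀ w w' : Fin 2 × Bool, w ≠ w' → Disjoint (startsWith w) (startsWith w') :=
    fun w w' h => startsWith.disjoint_iff_ne.2 h
  have hsum := hmono (startsWith ((0 : Fin 2), true) ∪ startsWith (0, false) ∪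
    (startsWith (1, true) ∪ startsWith (1, false))) Set.univ (Set.subset_univ _)
  rw [hadd _ _ ?_, hadd _ _ (hdisj _ _ (by decide)), hadd _ _ (hdisj _ _ (by decide)), h1] at hsum
  · linarith [hpair 0, hpair 1]
  · simp only [Set.disjoint_union_left, Set.disjoint_union_right]
    exact ⟨⟨hdisj _ _ (by decide), hdisj _ _ (by decide)⟩,
      ⟨hdisj _ _ (by decide), hdisj _ _ (by decide)⟩⟩

theorem AmenableGroup.not_containsFreeGroup {G : Type u} [Group G] (h : AmenableGroup G) :
    ¬ ContainsFreeGroup G :=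
  fun ⟨φ, hφ⟩ => FreeGroup.not_amenableGroup_fin_two (h.of_injective φ hφ)

/-! ### Directed unions and local finiteness of `Sym₀` -/

theorem ElementaryAmenableGroup.of_iSup {G : Type u} [Group G] {ι : Type u} [Preorder ι]
    [IsDirectedOrder ι] [Nonempty ι] (H : ι → Subgroup G) (hH : Monotone H)
    (hEA : ∀ i, ElementaryAmenableGroup (H i)) (hmem : ∀ g, ∃ i, g ∈ H i) :
    ElementaryAmenableGroup G := by
  intro C hC
  let f : ∀ i j, i ≤ j → H i →* H j := fun i j hij => Subgroup.inclusion (hH hij)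
  have : DirectedSystem (fun i => H i) (f · · ·) :=
    ⟨fun _ _ => rfl, fun _ _ _ _ _ _ => rfl⟩
  let e : DirectLimit (fun i => H i) f →* G :=
    { toFun := DirectLimit.lift f (fun i x => (x : G)) (fun _ _ _ _ => rfl)
      map_one' := rfl
      map_mul' := DirectLimit.induction₂ f fun i x y => by
        rw [DirectLimit.mul_def]; rfl }
  refine hC.iso _ _ ⟨MulEquiv.ofBijective e ⟨?_, ?_⟩⟩
    (hC.directLimit ι (fun i => H i) f fun i => hEA i C hC)
  · exact DirectLimit.lift_injective f (fun i (x : H i) => (x : G)) (fun _ _ _ _ => rfl)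
      fun i => Subtype.val_injective
  · intro g
    obtain ⟨i, hi⟩ := hmem g
    exact ⟨⟦⟨i, ⟨g, hi⟩⟩⟧, rfl⟩

/-- The finitary permutations supported in `s`. -/
def FinitarySym.supportedIn {X : Type u} (s : Finset X) : Subgroup (FinitarySym X) where
  carrier := {σ | ∀ x ∉ s, (σ : Equiv.Perm X) x = x}
  one_mem' := fun _ _ => rfl
  mul_mem' := fun {σ τ} hσ hτ x hx => by
    rw [Subgroup.coe_mul, Equiv.Perm.mul_apply, hτ x hx, hσ x hx]
  inv_mem' := fun {σ} hσ x hx => by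
    rw [Subgroup.coe_inv, Equiv.Perm.inv_eq_iff_eq]
    exact (hσ x hx).symm

theorem FinitarySym.supportedIn_mono {X : Type u} :
    Monotone (FinitarySym.supportedIn (X := X)) :=
  fun _ _ hst _ hσ x hx => hσ x fun h => hx (hst h)

theorem FinitarySym.exists_mem_supportedIn {X : Type u} (σ : FinitarySym X) :
    ∃ s, σ ∈ FinitarySym.supportedIn s := by
  refine ⟨σ.2.toFinset, fun x hx => ?_⟩
  by_contra h
  exact hx (σ.2.mem_toFinset.2 h)

instance {X : Type u} (s : Finset X) : Finite (FinitarySym.supportedIn s) := by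
  classical
  have := Finite.of_equiv _ (Equiv.Perm.subtypeEquivSubtypePerm (· ∈ s))
  let F : FinitarySym.supportedIn s → { f : Equiv.Perm X // ∀ a, a ∉ s → f a = a } :=
    fun σ => ⟨σ.1.1, σ.2⟩
  refine Finite.of_injective F ?_
  intro σ τ h
  have h1 : (F σ).1 = (F τ).1 := by rw [h]
  exact Subtype.ext (Subtype.ext h1)

theorem FinitarySym.amenableGroup (X : Type u) : AmenableGroup (FinitarySym X) :=
  AmenableGroup.of_iSup_finite FinitarySym.supportedIn supportedIn_mono
    (fun _ => inferInstance) exists_mem_supportedIn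

theorem FinitarySym.elementaryAmenableGroup (X : Type u) :
    ElementaryAmenableGroup (FinitarySym X) :=
  ElementaryAmenableGroup.of_iSup FinitarySym.supportedIn supportedIn_mono
    (fun i _ hC => hC.finite (supportedIn i) inferInstance) exists_mem_supportedIn

/-! ### The finitary alternating group -/

open Equiv

/-- Extension by the identity of a permutation of a finite set. -/
def FinitarySym.ofFinset {X : Type u} [DecidableEq X] (s : Finset X) :
    Perm s →* FinitarySym X where
  toFun f := ⟨Perm.ofSubtype f, s.finite_toSet.subset fun x hx => by
    by_contra h
    exact hx (Perm.ofSubtype_apply_of_not_mem f h)⟩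
  map_one' := Subtype.ext (map_one _)
  map_mul' f g := Subtype.ext (map_mul _ f g)

theorem FinitarySym.coe_ofFinset {X : Type u} [DecidableEq X] (s : Finset X) (f : Perm s) :
    (FinitarySym.ofFinset s f : Perm X) = Perm.ofSubtype f := rfl

theorem FinitaryAlt.mul_mem_of_isSwap {X : Type u} [DecidableEq X] {σ τ : FinitarySym X}
    (hσ : (σ : Perm X).IsSwap) (hτ : (τ : Perm X).IsSwap) : σ * τ ∈ FinitaryAlt X :=
  Subgroup.subset_closure ⟨σ, τ, hσ, hτ, rfl⟩

theorem FinitaryAlt.ofFinset_mem {X : Type u} [DecidableEq X] (s : Finset X) {f : Perm s}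
    (hf : f ∈ alternatingGroup s) : FinitarySym.ofFinset s f ∈ FinitaryAlt X := by
  -- The odd case, corrected by an arbitrary further transposition, is carried along so that the
  -- induction can add one transposition at a time.
  have key : ∀ f : Perm s, (Perm.sign f = 1 → FinitarySym.ofFinset s f ∈ FinitaryAlt X) ∧
      (Perm.sign f = -1 → ∀ τ : FinitarySym X, (τ : Perm X).IsSwap →
        τ * FinitarySym.ofFinset s f ∈ FinitaryAlt X) := by
    intro f
    induction f using Perm.swap_induction_on with
    | one => simp [one_mem]
    | swap_mul f x y hxy ih =>
      obtain ⟨ih₁, ih₂⟩ := ih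
      have hswap : (FinitarySym.ofFinset s (swap x y) : Perm X).IsSwap :=
        ⟨x, y, fun h => hxy (Subtype.ext h), Perm.ofSubtype_swap_eq x y⟩
      rw [Perm.sign_mul, Perm.sign_swap hxy, neg_one_mul, map_mul]
      refine ⟨fun h => ih₂ (neg_eq_iff_eq_neg.1 h) _ hswap, fun h τ hτ => ?_⟩
      rw [← mul_assoc]
      exact mul_mem (FinitaryAlt.mul_mem_of_isSwap hτ hswap) (ih₁ (neg_injective h))
  exact (key f).1 (Perm.mem_alternatingGroup.1 hf)

theorem FinitaryAlt.exists_ofFinset_eq {X : Type u} [DecidableEq X] {σ : FinitarySym X}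
    (hσ : σ ∈ FinitaryAlt X) : ∃ s₀ : Finset X, ∀ s, s₀ ⊆ s →
      ∃ f ∈ alternatingGroup s, FinitarySym.ofFinset s f = σ := by
  induction hσ using Subgroup.closure_induction with
  | mem σ h =>
    obtain ⟨_, _, ⟨x, y, hxy, rfl⟩, ⟨z, w, hzw, rfl⟩, h⟩ := h
    refine ⟨{x, y, z, w}, fun s hs => ?_⟩
    have hx : x ∈ s := hs (by simp)
    have hy : y ∈ s := hs (by simp)
    have hz : z ∈ s := hs (by simp)
    have hw : w ∈ s := hs (by simp)
    refine ⟨swap ⟨x, hx⟩ ⟨y, hy⟩ * swap ⟨z, hz⟩ ⟨w, hw⟩,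
      Perm.mul_mem_alternatingGroup_of_isSwap ⟨_, _, by simpa using hxy, rfl⟩
        ⟨_, _, by simpa using hzw, rfl⟩, Subtype.ext ?_⟩
    rw [h, FinitarySym.coe_ofFinset, map_mul, Perm.ofSubtype_swap_eq, Perm.ofSubtype_swap_eq]
  | one => exact ⟨∅, fun s _ => ⟨1, one_mem _, map_one _⟩⟩
  | mul σ τ _ _ h₁ h₂ =>
    obtain ⟨s₁, h₁⟩ := h₁
    obtain ⟨s₂, h₂⟩ := h₂
    refine ⟨s₁ ∪ s₂, fun s hs => ?_⟩
    obtain ⟨f, hf, rfl⟩ := h₁ s (Finset.union_subset_left hs)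
    obtain ⟨g, hg, rfl⟩ := h₂ s (Finset.union_subset_right hs)
    exact ⟨f * g, mul_mem hf hg, map_mul _ _ _⟩
  | inv σ _ h =>
    obtain ⟨s₀, h⟩ := h
    refine ⟨s₀, fun s hs => ?_⟩
    obtain ⟨f, hf, rfl⟩ := h s hs
    exact ⟨f⁻¹, inv_mem hf, map_inv _ _⟩

/-- Both `h` and a given `σ` lie in the alternating group of one finite set, which is simple once
that set has five points; `t` guarantees this. Not requiring `H` to lie inside `FinitaryAlt X` lets
the result serve for kernels on `FinitarySym X` too. -/
theorem FinitaryAlt.le_of_conj_mem {X : Type u} [DecidableEq X] [Infinite X]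
    (H : Subgroup (FinitarySym X)) (hH : ∀ a ∈ FinitaryAlt X, ∀ h ∈ H, a * h * a⁻¹ ∈ H)
    {h : FinitarySym X} (hh : h ∈ H) (hA : h ∈ FinitaryAlt X) (h1 : h ≠ 1) :
    FinitaryAlt X ≤ H := by
  intro σ hσ
  obtain ⟨s₁, h₁⟩ := FinitaryAlt.exists_ofFinset_eq hA
  obtain ⟨s₂, h₂⟩ := FinitaryAlt.exists_ofFinset_eq hσ
  obtain ⟨t, ht⟩ := Infinite.exists_subset_card_eq X 5
  let s := s₁ ∪ s₂ ∪ t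
  obtain ⟨f, hf, hfh⟩ := h₁ s (Finset.subset_union_left.trans Finset.subset_union_left)
  obtain ⟨g, hg, hgσ⟩ := h₂ s (Finset.subset_union_right.trans Finset.subset_union_left)
  have : IsSimpleGroup (alternatingGroup s) := alternatingGroup.isSimpleGroup (by
    rw [Nat.card_eq_fintype_card, Fintype.card_coe, ← ht]
    exact Finset.card_le_card Finset.subset_union_right)
  let K : Subgroup (alternatingGroup s) :=
    H.comap ((FinitarySym.ofFinset s).comp (alternatingGroup s).subtype)
  have hK : K.Normal := ⟨fun n hn a => by
    simp only [K, Subgroup.mem_comap, map_mul, map_inv] at hn ⊢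
    exact hH _ (FinitaryAlt.ofFinset_mem s a.2) _ hn⟩
  rcases hK.eq_bot_or_eq_top with hbot | htop
  · have hmem : (⟨f, hf⟩ : alternatingGroup s) ∈ K := by
      rw [Subgroup.mem_comap]
      exact hfh ▸ hh
    rw [hbot, Subgroup.mem_bot] at hmem
    refine absurd ?_ h1
    rw [← hfh, show f = 1 from congrArg Subtype.val hmem, map_one]
  · have hmem : (⟨g, hg⟩ : alternatingGroup s) ∈ K := htop ▸ Subgroup.mem_top _
    exact hgσ ▸ (Subgroup.mem_comap.1 hmem)

/-- The transposition of `x` and `y` as a finitary permutation. -/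
def FinitarySym.swap {X : Type u} [DecidableEq X] (x y : X) : FinitarySym X :=
  ⟨Equiv.swap x y, (Set.toFinite {x, y}).subset fun z hz => by
    by_contra h
    simp only [Set.mem_insert_iff, Set.mem_singleton_iff, not_or] at h
    exact hz (Equiv.swap_apply_of_ne_of_ne h.1 h.2)⟩

theorem FinitaryAlt.nontrivial (X : Type u) [DecidableEq X] [Infinite X] :
    Nontrivial (FinitaryAlt X) := by
  obtain ⟨t, ht⟩ := Infinite.exists_subset_card_eq X 3
  obtain ⟨x, y, z, hxy, hxz, hyz, -⟩ := Finset.card_eq_three.1 ht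
  refine ⟨⟨⟨FinitarySym.swap x y * FinitarySym.swap y z,
    FinitaryAlt.mul_mem_of_isSwap ⟨x, y, hxy, rfl⟩ ⟨y, z, hyz, rfl⟩⟩, 1, fun h => hxy ?_⟩⟩
  have h1 := congrArg (fun σ : FinitaryAlt X => (σ : Perm X) x) h
  simpa [FinitarySym.swap, Equiv.swap_apply_of_ne_of_ne hxy hxz] using h1.symm

theorem FinitaryAlt.isSimpleGroup (X : Type u) [DecidableEq X] [Infinite X] :
    IsSimpleGroup (FinitaryAlt X) where
  exists_pair_ne := (FinitaryAlt.nontrivial X).exists_pair_ne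
  eq_bot_or_eq_top_of_normal H hH := by
    rw [or_iff_not_imp_left]
    intro hbot
    obtain ⟨⟨h, hh⟩, h1⟩ := H.ne_bot_iff_exists_ne_one.1 hbot
    have hle : FinitaryAlt X ≤ H.map (FinitaryAlt X).subtype := by
      refine FinitaryAlt.le_of_conj_mem _ ?_ (h := h) ⟨h, hh, rfl⟩ h.2 ?_
      · rintro a ha _ ⟨b, hb, rfl⟩
        exact ⟨⟨a, ha⟩ * b * ⟨a, ha⟩⁻¹, hH.conj_mem b hb ⟨a, ha⟩, rfl⟩
      · intro h2
        exact h1 (Subtype.ext (Subtype.ext h2))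
    rw [eq_top_iff]
    intro a _
    obtain ⟨b, hb, hba⟩ := hle a.2
    rwa [← Subtype.ext (a1 := b) (a2 := a) hba]

-- For a transposition `σ`, `hσh⁻¹` is again a transposition, so the commutator is even. Taking `σ =
-- (x b)` with `h x ≠ x` and `b` outside `{x, h x}` makes it nontrivial.
open scoped commutatorElement in
theorem FinitaryAlt.exists_commutator_mem {X : Type u} [DecidableEq X] [Infinite X]
    {h : FinitarySym X} (h1 : h ≠ 1) :
    ∃ σ : FinitarySym X, ⁅h, σ⁆ ∈ FinitaryAlt X ∧ ⁅h, σ⁆ ≠ 1 := by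
  obtain ⟨x, hx⟩ : ∃ x, (h : Perm X) x ≠ x := by
    by_contra! hc
    exact h1 (Subtype.ext (Equiv.ext hc))
  obtain ⟨b, hb⟩ := Infinite.exists_notMem_finset ({x, (h : Perm X) x} : Finset X)
  simp only [Finset.mem_insert, Finset.mem_singleton, not_or] at hb
  refine ⟨FinitarySym.swap x b, ?_, ?_⟩
  · rw [commutatorElement_def]
    refine FinitaryAlt.mul_mem_of_isSwap ⟨(h : Perm X) x, (h : Perm X) b, ?_, ?_⟩
      ⟨x, b, Ne.symm hb.1, Equiv.swap_inv x b⟩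
    · exact fun h2 => hb.1 ((h : Perm X).injective h2).symm
    · exact (Equiv.swap_apply_apply _ x b).symm
  · rw [Ne, commutatorElement_eq_one_iff_mul_comm]
    intro h2
    have h3 := congrArg (fun σ : FinitarySym X => (σ : Perm X) x) h2
    simp only [FinitarySym.swap, Subgroup.coe_mul, Perm.mul_apply, Equiv.swap_apply_left] at h3
    rw [Equiv.swap_apply_of_ne_of_ne hx (Ne.symm hb.2)] at h3
    exact hb.1 ((h : Perm X).injective h3)

/-! ### A free subgroup in a power of `Sym₀` -/

theorem FinitarySym.exists_eqOn {X : Type u} (g : Perm X) (B : Finset X) :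
    ∃ σ : FinitarySym X, ∀ x ∈ B, (σ : Perm X) x = g x := by
  classical
  induction B using Finset.induction_on with
  | empty => exact ⟨1, by simp⟩
  | insert x B hx ih =>
    obtain ⟨σ, hσ⟩ := ih
    refine ⟨FinitarySym.swap ((σ : Perm X) x) (g x) * σ, fun y hy => ?_⟩
    rcases Finset.mem_insert.1 hy with rfl | hy
    · exact Equiv.swap_apply_left _ _
    · have hne : y ≠ x := fun h => hx (h ▸ hy)
      refine (Equiv.swap_apply_of_ne_of_ne ((σ : Perm X).injective.ne hne) ?_).trans (hσ y hy)
      rw [hσ y hy]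
      exact g.injective.ne hne

theorem FreeGroup.exists_finitarySym_apply_eq {α : Type*} {X : Type u}
    (ρ : FreeGroup α →* Perm X) (w : FreeGroup α) (p : X) :
    ∃ f : FreeGroup α →* FinitarySym X, (f w : Perm X) p = ρ w p := by
  classical
  -- These are the points visited as the letters of `w` act on `p` from the right; agreement with
  -- the generators on them suffices, for inverse letters too.
  let B : Finset X := (w.toWord.tails.map fun t => ρ (mk t) p).toFinset
  choose c hc using fun i => FinitarySym.exists_eqOn (ρ (of i)) B
  refine ⟨FreeGroup.lift c, ?_⟩
  have key : ∀ t : List (α × Bool), t <:+ w.toWord →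
      ((FreeGroup.lift c (mk t) : FinitarySym X) : Perm X) p = ρ (mk t) p := by
    intro t
    induction t with
    | nil => intro _; simp [← FreeGroup.one_eq_mk]
    | cons a t ih =>
      intro ht
      have ht' : t <:+ w.toWord := (List.suffix_cons a t).trans ht
      have hB : ∀ t, t <:+ w.toWord → ρ (mk t) p ∈ B := fun t ht => by
        simp only [B, List.mem_toFinset, List.mem_map, List.mem_tails]
        exact ⟨t, ht, rfl⟩
      have hsplit : mk (a :: t) = mk [a] * mk t := by rw [mul_mk]; rfl
      have h1 := hB _ ht
      rw [hsplit, _root_.map_mul, _root_.map_mul, Subgroup.coe_mul, Perm.mul_apply, Perm.mul_apply, ih ht']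
      rw [hsplit, _root_.map_mul, Perm.mul_apply] at h1
      obtain ⟨i, b⟩ := a
      cases b with
      | true =>
        change ((FreeGroup.lift c (of i) : FinitarySym X) : Perm X) _ = ρ (of i) _
        rw [lift_apply_of]
        exact hc i _ (hB t ht')
      | false =>
        have hi : (mk [(i, false)] : FreeGroup α) = (of i)⁻¹ := rfl
        rw [hi, _root_.map_inv, _root_.map_inv, lift_apply_of, Subgroup.coe_inv, Perm.inv_eq_iff_eq]
        rw [hi, _root_.map_inv] at h1
        rw [hc i _ h1]
        simp
  simpa [mk_toWord] using key w.toWord List.suffix_rfl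

theorem containsFreeGroup_pi_finitarySym (ι : Type*) (X : Type u) [Countable ι] [Infinite ι]
    [Countable X] [Infinite X] : ContainsFreeGroup (ι → FinitarySym X) := by
  have : Countable (FreeGroup (Fin 2)) := FreeGroup.toWord_injective.countable
  obtain ⟨e⟩ := nonempty_equiv_of_countable (α := FreeGroup (Fin 2)) (β := X)
  obtain ⟨d⟩ := nonempty_equiv_of_countable (α := FreeGroup (Fin 2)) (β := ι)
  -- The left regular action, transported to `X`, is free; the coordinate `d w` is chosen to detect
  -- `w`.
  let ρ : FreeGroup (Fin 2) →* Perm X :=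
    (e.permCongrHom : Perm (FreeGroup (Fin 2)) →* Perm X).comp (MulAction.toPermHom _ _)
  have hρ : ∀ w, ρ w (e 1) = e w := fun w => by simp [ρ]
  choose f hf using fun w => FreeGroup.exists_finitarySym_apply_eq ρ w (e 1)
  refine ⟨MonoidHom.pi fun i => f (d.symm i), ?_⟩
  rw [injective_iff_map_eq_one]
  intro w hw
  have h1 := congrFun hw (d w)
  simp only [MonoidHom.pi_apply, Equiv.symm_apply_apply, Pi.one_apply] at h1
  have h2 := hf w
  rw [h1, hρ] at h2
  exact e.injective h2.symm

/-! ### The wreath product and its quotients -/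

namespace RegularWreathProduct

variable {D Q : Type*} [Group D] [Group Q]

/-- The inclusion of the base group `Q → D`. -/
def baseHom : (Q → D) →* RegularWreathProduct D Q where
  toFun f := ⟨f, 1⟩
  map_one' := rfl
  map_mul' f g := by ext <;> simp

/-- The evaluation of the base group at a coordinate. -/
def evalKer (q : Q) : (rightHom : RegularWreathProduct D Q →* Q).ker →* D where
  toFun a := a.1.left q
  map_one' := rfl
  map_mul' a b := by
    have ha : a.1.right = 1 := a.2
    simp [ha]

theorem evalKer_surjective (q : Q) : Function.Surjective (evalKer (D := D) q) :=
  fun d => ⟨⟨baseHom fun _ => d, rfl⟩, rfl⟩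

theorem rightHom_surjective : Function.Surjective (rightHom : RegularWreathProduct D Q →* Q) :=
  fun q => ⟨inl q, rfl⟩

variable [DecidableEq Q]

theorem conj_baseHom_mulSingle (q r : Q) (d : D) :
    inl r * baseHom (Pi.mulSingle q d) * (inl r)⁻¹ =
      (baseHom (Pi.mulSingle (r * q) d) : RegularWreathProduct D Q) := by
  ext1
  · funext x
    have : (r⁻¹ * x = q) ↔ x = r * q := inv_mul_eq_iff_eq_mul
    simp [baseHom, Pi.mulSingle_apply, this]
  · simp [baseHom]

end RegularWreathProduct

theorem residuallyIn_ker_rightHom {C : ∀ (G : Type u) [Group G], Prop} {D Q : Type u}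
    [Group D] [Group Q] (hD : C D) :
    ResiduallyIn C (RegularWreathProduct.rightHom : RegularWreathProduct D Q →* Q).ker := by
  intro g hg
  obtain ⟨q, hq⟩ : ∃ q, g.1.left q ≠ 1 := by
    by_contra! hc
    exact hg (Subtype.ext (RegularWreathProduct.ext (funext hc) g.2))
  exact ⟨D, inferInstance, RegularWreathProduct.evalKer q, hD,
    RegularWreathProduct.evalKer_surjective q, hq⟩

open RegularWreathProduct in
open scoped commutatorElement in
theorem not_residuallyIn_wreath_finitarySym {C : ∀ (G : Type u) [Group G], Prop}
    (hC : ∀ (G : Type u) [Group G], C G → ¬ ContainsFreeGroup G) (X Q : Type u) [Group Q]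
    [Countable X] [Infinite X] [Countable Q] [Infinite Q] :
    ¬ ResiduallyIn C (RegularWreathProduct (FinitarySym X) Q) := by
  classical
  intro hres
  have := FinitaryAlt.nontrivial X
  obtain ⟨⟨σ₀, hσ₀⟩, hne⟩ := exists_ne (1 : FinitaryAlt X)
  obtain ⟨R, _, φ, hR, -, hφ⟩ := hres (baseHom (Pi.mulSingle 1 σ₀)) (by
    intro h
    apply hne
    have h1 := congrArg (fun a => a.left 1) h
    exact Subtype.ext (by simpa [baseHom] using h1))
  refine hC R hR ((containsFreeGroup_pi_finitarySym Q X).of_injective (f := φ.comp baseHom) ?_)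
  rw [injective_iff_map_eq_one]
  intro f hf
  by_contra hf1
  obtain ⟨q, hq⟩ := Function.ne_iff.1 hf1
  let δ : FinitarySym X →* RegularWreathProduct (FinitarySym X) Q :=
    baseHom.comp (MonoidHom.mulSingle (fun _ => FinitarySym X) q)
  let H := (φ.comp δ).ker
  obtain ⟨σ, hσA, hσ1⟩ := FinitaryAlt.exists_commutator_mem hq
  have hmem : ⁅f q, σ⁆ ∈ H := by
    have h1 : δ ⁅f q, σ⁆ = ⁅(baseHom f : RegularWreathProduct (FinitarySym X) Q), δ σ⁆ := by
      simp only [δ, MonoidHom.comp_apply]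
      rw [← map_commutatorElement (baseHom (D := FinitarySym X) (Q := Q))]
      congr 1
      funext r
      by_cases hr : r = q
      · subst hr
        simp [commutatorElement_def]
      · simp [commutatorElement_def, hr]
    rw [MonoidHom.mem_ker, MonoidHom.comp_apply, h1, map_commutatorElement,
      show φ (baseHom f) = 1 from hf, commutatorElement_one_left]
  have hle : FinitaryAlt X ≤ H := FinitaryAlt.le_of_conj_mem H
    (fun a _ h hh => (MonoidHom.normal_ker _).conj_mem h hh a) hmem hσA hσ1
  have h2 : φ (baseHom (Pi.mulSingle q σ₀)) = 1 := hle hσ₀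
  apply hφ
  -- Shifting by `q⁻¹` carries coordinate `q` to coordinate `1`, where the supposedly detected
  -- element sits.
  have h3 := conj_baseHom_mulSingle q q⁻¹ σ₀
  rw [inv_mul_cancel] at h3
  rw [← h3, map_mul, map_mul, h2, mul_one, ← map_mul, mul_inv_cancel, map_one]

theorem proposition4 :
    ¬ ClosedUnderExtensionsBy.{0} (ResiduallyIn AmenableGroup) AmenableGroup ∧
    ¬ ClosedUnderExtensionsBy.{0} (ResiduallyIn ElementaryAmenableGroup)
        ElementaryAmenableGroup ∧
    ResiduallyIn AmenableGroup SymWreathBase ∧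
    ResiduallyIn ElementaryAmenableGroup SymWreathBase ∧
    AmenableGroup (SymWreath ⧸ SymWreathBase) ∧
    ElementaryAmenableGroup (SymWreath ⧸ SymWreathBase) ∧
    ¬ ResiduallyIn AmenableGroup SymWreath ∧
    ¬ ResiduallyIn ElementaryAmenableGroup SymWreath ∧
    (∃ φ : FreeGroup (Fin 2) →* (ℤ → FinitarySym ℤ), Function.Injective φ) ∧
    IsSimpleGroup (FinitaryAlt ℤ) := by
  have : Countable (Multiplicative ℤ) := Multiplicative.ofAdd.symm.injective.countable
  have hA : ResiduallyIn AmenableGroup SymWreathBase :=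
    residuallyIn_ker_rightHom (FinitarySym.amenableGroup ℤ)
  have hE : ResiduallyIn ElementaryAmenableGroup SymWreathBase :=
    residuallyIn_ker_rightHom (FinitarySym.elementaryAmenableGroup ℤ)
  have e : Multiplicative ℤ ≃* SymWreath ⧸ SymWreathBase :=
    (QuotientGroup.quotientKerEquivOfSurjective _
      RegularWreathProduct.rightHom_surjective).symm
  have hAQ : AmenableGroup (SymWreath ⧸ SymWreathBase) :=
    amenableGroup_multiplicative_int.of_surjective e.toMonoidHom e.surjective
  have hEQ : ElementaryAmenableGroup (SymWreath ⧸ SymWreathBase) := fun C hC =>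
    hC.iso (Multiplicative ℤ) _ ⟨e⟩ (hC.solvable _ inferInstance)
  have hAn : ¬ ResiduallyIn AmenableGroup SymWreath :=
    not_residuallyIn_wreath_finitarySym (fun _ _ h => h.not_containsFreeGroup) _ _
  have hEn : ¬ ResiduallyIn ElementaryAmenableGroup SymWreath :=
    not_residuallyIn_wreath_finitarySym (fun _ _ h => h.not_containsFreeGroup) _ _
  exact ⟨fun h => hAn (h _ SymWreathBase hA hAQ), fun h => hEn (h _ SymWreathBase hE hEQ),
    hA, hE, hAQ, hEQ, hAn, hEn, containsFreeGroup_pi_finitarySym ℤ ℤ,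
    FinitaryAlt.isSimpleGroup ℤ⟩
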